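/- \textbf{Theorem.} Let $\mathcal N$ be the variety of lattices generated by the pentagon $N_5$, that is, the class of all lattices that satisfy every lattice identity satisfied by $N_5$. Let $L\in\mathcal N$, and assume that $L$ is isomorphic to a sublattice of a free lattice. Let $K$ be a sublattice of $L$ and let $a\in L$ be such that, for every $b\in K$, neither $a\le b$ nor $b\le a$ holds. Then $$\mathrm{Dec}(K)\;\le\;\bigl|\{a\vee b : b\in K\}\times\{a\wedge b : b\in K\}\bigr|$$ as (possibly infinite) cardinals. Here, for a lattice $K$, a \emph{convex distributive sublattice} of $K$ is a subset $F\subseteq K$ that is closed under joins and meets, is convex in $K$ (if $x,y\in F$, $z\in K$ and $x\le z\le y$, then $z\in F$) and satisfies the distributive laws. A \emph{distributive partition} of $K$ is a partition $\mathcal F$ of the set of elements of $K$ into non-empty subsets such that every $F\in\mathcal F$ is a convex distributive sublattice of $K$ and, for all distinct $F_1,F_2\in\mathcal F$, either $F_1\cup F_2$ is not a sublattice of $K$, or $F_1\cup F_2$ is not a convex subset of $K$, or $F_1\cup F_2$ is a convex distributive sublattice of $K$. Then $\mathrm{Dec}(K)$ is the minimum cardinality of a distributive partition of $K$ (the partition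 into singletons is distributive, so this minimum exists). -/

import Mathlib

universe u v

/-- Lattice terms in variables from `S`. -/
inductive LatticeTerm (S : Type u) : Type u
  | var : S → LatticeTerm S
  | join : LatticeTerm S → LatticeTerm S → LatticeTerm S
  | meet : LatticeTerm S → LatticeTerm S → LatticeTerm S

namespace LatticeTerm

/-- The value of a lattice term in a lattice `M` under an assignment of the variables. -/
def eval {S : Type u} {M : Type v} [Lattice M] (f : S → M) : LatticeTerm S → M
  | var s => f s
  | join p q => eval f p ⊔ eval f q
  | meet p q => eval f p ⊓ eval f q

/-- The inequalities between lattice terms that follow from the lattice axioms alone. -/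
inductive Le {S : Type u} : LatticeTerm S → LatticeTerm S → Prop
  | refl (p : LatticeTerm S) : Le p p
  | trans {p q r : LatticeTerm S} : Le p q → Le q r → Le p r
  | left_le_join (p q : LatticeTerm S) : Le p (join p q)
  | right_le_join (p q : LatticeTerm S) : Le q (join p q)
  | join_le {p q r : LatticeTerm S} : Le p r → Le q r → Le (join p q) r
  | meet_le_left (p q : LatticeTerm S) : Le (meet p q) p
  | meet_le_right (p q : LatticeTerm S) : Le (meet p q) q
  | le_meet {p q r : LatticeTerm S} : Le p q → Le p r → Le p (meet q r)

instance {S : Type u} : Preorder (LatticeTerm S) where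
  le := Le
  le_refl := Le.refl
  le_trans _ _ _ := Le.trans

theorem eval_mono {S : Type u} {M : Type v} [Lattice M] (f : S → M) {p q : LatticeTerm S}
    (h : p ≤ q) : p.eval f ≤ q.eval f := by
  induction h with
  | refl p => exact le_rfl
  | trans _ _ h1 h2 => exact h1.trans h2
  | left_le_join p q => exact le_sup_left
  | right_le_join p q => exact le_sup_right
  | join_le _ _ h1 h2 => exact sup_le h1 h2
  | meet_le_left p q => exact inf_le_left
  | meet_le_right p q => exact inf_le_right
  | le_meet _ _ h1 h2 => exact le_inf h1 h2

end LatticeTerm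

/-- The free lattice on `S`: lattice terms modulo the equations that follow from the
lattice axioms. -/
def FreeLattice (S : Type u) : Type u :=
  Antisymmetrization (LatticeTerm S) (· ≤ ·)

namespace FreeLattice

instance {S : Type u} : PartialOrder (FreeLattice S) :=
  inferInstanceAs (PartialOrder (Antisymmetrization (LatticeTerm S) (· ≤ ·)))

/-- The class of a lattice term in the free lattice. -/
def mk {S : Type u} (p : LatticeTerm S) : FreeLattice S :=
  toAntisymmetrization (· ≤ ·) p

theorem mk_le_mk {S : Type u} {p q : LatticeTerm S} : mk p ≤ mk q ↔ p ≤ q := Iff.rfl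

theorem ind {S : Type u} {C : FreeLattice S → Prop} (h : ∀ p, C (mk p)) (x : FreeLattice S) :
    C x :=
  Quotient.inductionOn x h

instance {S : Type u} : Lattice (FreeLattice S) where
  sup := Quotient.map₂ LatticeTerm.join fun _ _ h₁ _ _ h₂ =>
    ⟨.join_le (.trans h₁.1 (.left_le_join _ _)) (.trans h₂.1 (.right_le_join _ _)),
     .join_le (.trans h₁.2 (.left_le_join _ _)) (.trans h₂.2 (.right_le_join _ _))⟩
  inf := Quotient.map₂ LatticeTerm.meet fun _ _ h₁ _ _ h₂ =>
    ⟨.le_meet (.trans (.meet_le_left _ _) h₁.1) (.trans (.meet_le_right _ _) h₂.1),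
     .le_meet (.trans (.meet_le_left _ _) h₁.2) (.trans (.meet_le_right _ _) h₂.2)⟩
  le_sup_left := by rintro ⟨p⟩ ⟨q⟩; exact LatticeTerm.Le.left_le_join p q
  le_sup_right := by rintro ⟨p⟩ ⟨q⟩; exact LatticeTerm.Le.right_le_join p q
  sup_le := by rintro ⟨p⟩ ⟨q⟩ ⟨r⟩ h₁ h₂; exact LatticeTerm.Le.join_le h₁ h₂
  inf_le_left := by rintro ⟨p⟩ ⟨q⟩; exact LatticeTerm.Le.meet_le_left p q
  inf_le_right := by rintro ⟨p⟩ ⟨q⟩; exact LatticeTerm.Le.meet_le_right p q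
  le_inf := by rintro ⟨p⟩ ⟨q⟩ ⟨r⟩ h₁ h₂; exact LatticeTerm.Le.le_meet h₁ h₂

/-- The free generators. -/
def of {S : Type u} (s : S) : FreeLattice S := mk (.var s)

theorem mk_join {S : Type u} (p q : LatticeTerm S) : mk (.join p q) = mk p ⊔ mk q := rfl

theorem mk_meet {S : Type u} (p q : LatticeTerm S) : mk (.meet p q) = mk p ⊓ mk q := rfl

/-- The lattice homomorphism that extends a function on the generators. -/
def lift {S : Type u} {M : Type v} [Lattice M] (f : S → M) : LatticeHom (FreeLattice S) M where
  toFun := Quotient.lift (LatticeTerm.eval f) fun _ _ h =>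
    le_antisymm (LatticeTerm.eval_mono f h.1) (LatticeTerm.eval_mono f h.2)
  map_sup' := by rintro ⟨p⟩ ⟨q⟩; rfl
  map_inf' := by rintro ⟨p⟩ ⟨q⟩; rfl

/-- The universal property of the free lattice. -/
theorem existsUnique_lift {S : Type u} {M : Type v} [Lattice M] (f : S → M) :
    ∃! g : LatticeHom (FreeLattice S) M, ∀ s, g (of s) = f s := by
  refine ⟨lift f, fun s => rfl, fun g hg => ?_⟩
  ext x
  induction x using ind with
  | h p =>
    induction p with
    | var s => exact hg s
    | join p q hp hq => rw [mk_join, map_sup, map_sup, hp, hq]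
    | meet p q hp hq => rw [mk_meet, map_inf, map_inf, hp, hq]

end FreeLattice

/-- The pentagon `N₅`: `bot < low < high < top`, `bot < side < top`, and `side` is incomparable
to `low` and to `high`. -/
inductive Pentagon : Type
  | bot | low | high | side | top
  deriving DecidableEq

namespace Pentagon

instance : Fintype Pentagon :=
  ⟨{bot, low, high, side, top}, by intro x; cases x <;> decide⟩

/-- Joins in the pentagon. -/
def sup : Pentagon → Pentagon → Pentagon
  | bot, y => y
  | x, bot => x
  | low, low => low
  | low, high => high
  | high, low => high
  | high, high => high
  | side, side => side
  | _, _ => top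

/-- Meets in the pentagon. -/
def inf : Pentagon → Pentagon → Pentagon
  | top, y => y
  | x, top => x
  | high, high => high
  | low, high => low
  | high, low => low
  | low, low => low
  | side, side => side
  | _, _ => bot

instance : Max Pentagon := ⟨sup⟩

instance : Min Pentagon := ⟨inf⟩

instance : Lattice Pentagon :=
  Lattice.mk' (by decide) (by decide) (by decide) (by decide) (by decide) (by decide)

end Pentagon

/-- `L` satisfies the lattice identity `p = q`. -/
def SatisfiesIdentity (L : Type u) [Lattice L] (p q : LatticeTerm ℕ) : Prop :=
  ∀ f : ℕ → L, p.eval f = q.eval f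

/-- Membership in the variety of lattices generated by the lattice `M`: `L` is a model of all
lattice identities that hold in `M`. -/
def InVarietyGeneratedBy (M : Type v) [Lattice M] (L : Type u) [Lattice L] : Prop :=
  ∀ p q : LatticeTerm ℕ, SatisfiesIdentity M p q → SatisfiesIdentity L p q

/-- A convex distributive sublattice of a lattice, as a set of elements. -/
structure IsConvexDistributiveSublattice {K : Type u} [Lattice K] (F : Set K) : Prop where
  isSublattice : IsSublattice F
  ordConnected : F.OrdConnected
  sup_inf_distrib : ∀ x ∈ F, ∀ y ∈ F, ∀ z ∈ F, x ⊔ (y ⊓ z) = (x ⊔ y) ⊓ (x ⊔ z)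
  inf_sup_distrib : ∀ x ∈ F, ∀ y ∈ F, ∀ z ∈ F, x ⊓ (y ⊔ z) = (x ⊓ y) ⊔ (x ⊓ z)

/-- A distributive partition of the lattice `K`. -/
structure IsDistributivePartition {K : Type u} [Lattice K] (P : Set (Set K)) : Prop where
  isPartition : Setoid.IsPartition P
  convexDistributive : ∀ F ∈ P, IsConvexDistributiveSublattice F
  union : ∀ F₁ ∈ P, ∀ F₂ ∈ P, F₁ ≠ F₂ →
    ¬ IsSublattice (F₁ ∪ F₂) ∨ ¬ (F₁ ∪ F₂).OrdConnected ∨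
      IsConvexDistributiveSublattice (F₁ ∪ F₂)

/-- `Dec K` is the least cardinality of a distributive partition of `K`. -/
noncomputable def Dec (K : Type u) [Lattice K] : Cardinal.{u} :=
  sInf {κ | ∃ P : Set (Set K), IsDistributivePartition P ∧ Cardinal.mk P = κ}

/-- The partition into singletons is distributive, so the minimum in `Dec` is over a non-empty
set of cardinals. -/
theorem isDistributivePartition_singletons (K : Type u) [Lattice K] :
    IsDistributivePartition (Set.range fun x : K => ({x} : Set K)) := by
  refine ⟨⟨?_, fun x => ⟨{x}, ⟨⟨x, rfl⟩, rfl⟩, ?_⟩⟩, ?_, ?_⟩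
  · rintro ⟨x, hx⟩
    exact Set.singleton_ne_empty x hx
  · rintro _ ⟨⟨y, rfl⟩, hy⟩
    rw [Set.mem_singleton_iff.1 hy]
  · rintro _ ⟨x, rfl⟩
    refine ⟨⟨?_, ?_⟩, Set.ordConnected_singleton, ?_, ?_⟩
    · rintro _ rfl _ rfl; simp
    · rintro _ rfl _ rfl; simp
    · rintro _ rfl _ rfl _ rfl; simp
    · rintro _ rfl _ rfl _ rfl; simp
  · rintro _ ⟨x, rfl⟩ _ ⟨y, rfl⟩ -
    by_cases h₁ : IsSublattice ({x} ∪ {y} : Set K)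
    · by_cases h₂ : ({x} ∪ {y} : Set K).OrdConnected
      · have hs : x ≤ y ∨ y ≤ x := by
          simpa using h₁.supClosed (Or.inl rfl : x ∈ _) (Or.inr rfl : y ∈ _)
        refine Or.inr (Or.inr ⟨h₁, h₂, ?_, ?_⟩) <;> rcases hs with hs | hs <;>
          rintro a (rfl | rfl) b (rfl | rfl) c (rfl | rfl) <;> simp [hs]
      · exact Or.inr (Or.inl h₂)
    · exact Or.inl h₁

/-- The minimum in `Dec` is attained. -/
theorem exists_isDistributivePartition_mk_eq_dec (K : Type u) [Lattice K] :
    ∃ P : Set (Set K), IsDistributivePartition P ∧ Cardinal.mk P = Dec K :=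
  csInf_mem (s := {κ | ∃ P : Set (Set K), IsDistributivePartition P ∧ Cardinal.mk P = κ})
    ⟨_, _, isDistributivePartition_singletons K, rfl⟩

/-! Partition $K$ into the fibers of $b\mapsto(a\vee b,a\wedge b)$; their number is at most the size
of the product. A fiber is convex by monotonicity and a sublattice because lattices in $\mathcal N$
are semidistributive. It remains to see that a sublattice $G$ covered by two fibers is distributive.
If the elements $p\le q$ and $r$ of $G$ span a pentagon, semidistributivity forces $p$, $q$ and one
of $p\vee r$, $p\wedge r$ into one fiber; a four-variable law of $N_5$ then gives $p=q$
(`eq_of_sup_eq_of_inf_eq`). So $G$ is modular, and modularity with semidistributivity yields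
distributivity. -/

namespace InVarietyGeneratedBy

/-! ### Consequences of the identities of the pentagon -/

open LatticeTerm

variable {L : Type u} [Lattice L]

/-- The meet-semidistributive identity of the pentagon. -/
theorem inf_sup_eq (hN : InVarietyGeneratedBy Pentagon L) (x y z : L) :
    x ⊓ (y ⊔ z) = x ⊓ (y ⊔ (x ⊓ (z ⊔ (x ⊓ y)))) := by
  refine hN (meet (var 0) (join (var 1) (var 2)))
    (meet (var 0) (join (var 1) (meet (var 0) (join (var 2) (meet (var 0) (var 1)))))) ?_
    (fun n => if n = 0 then x else if n = 1 then y else z)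
  intro f
  simp only [eval]
  generalize f 0 = x, f 1 = y, f 2 = z
  revert x y z
  decide

/-- The join-semidistributive identity of the pentagon. -/
theorem sup_inf_eq (hN : InVarietyGeneratedBy Pentagon L) (x y z : L) :
    x ⊔ (y ⊓ z) = x ⊔ (y ⊓ (x ⊔ (z ⊓ (x ⊔ y)))) := by
  refine hN (join (var 0) (meet (var 1) (var 2)))
    (join (var 0) (meet (var 1) (join (var 0) (meet (var 2) (join (var 0) (var 1)))))) ?_
    (fun n => if n = 0 then x else if n = 1 then y else z)
  intro f
  simp only [eval]
  generalize f 0 = x, f 1 = y, f 2 = z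
  revert x y z
  decide

/-- Since `a ⊓ b ≤ c`, the nested term of `inf_sup_eq` collapses to `a ⊓ c = a ⊓ b`, which `b`
absorbs. -/
theorem inf_sup_eq_of_inf_eq (hN : InVarietyGeneratedBy Pentagon L) {a b c : L}
    (h : a ⊓ b = a ⊓ c) : a ⊓ (b ⊔ c) = a ⊓ b := by
  have hc : c ⊔ a ⊓ b = c := sup_eq_left.2 (h ▸ inf_le_right)
  rw [hN.inf_sup_eq, hc, ← h, sup_eq_left.2 inf_le_right]

theorem sup_inf_eq_of_sup_eq (hN : InVarietyGeneratedBy Pentagon L) {a b c : L}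
    (h : a ⊔ b = a ⊔ c) : a ⊔ (b ⊓ c) = a ⊔ b := by
  have hc : c ⊓ (a ⊔ b) = c := inf_eq_left.2 (h ▸ le_sup_right)
  rw [hN.sup_inf_eq, hc, ← h, inf_eq_left.2 le_sup_right]

/-- In the pentagon, two elements that are complementary to `p < q` have a meet not below `p`. -/
theorem inf_sup_le_sup_inf_sup_inf (hN : InVarietyGeneratedBy Pentagon L) {p q : L} (h : p ≤ q)
    (r a : L) : q ⊓ (p ⊔ r) ⊓ (p ⊔ a) ≤ p ⊔ (q ⊓ r) ⊔ (q ⊓ a) ⊔ (r ⊓ a) := by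
  -- The inequality `s ≤ t` is encoded as the identity `s ⊓ t = s`, and the hypothesis `p ≤ q` by
  -- writing `p ⊔ q` for `q`.
  let s : LatticeTerm ℕ := meet (meet (join (var 0) (var 1)) (join (var 0) (var 2)))
    (join (var 0) (var 3))
  let t : LatticeTerm ℕ := join (join (join (var 0) (meet (join (var 0) (var 1)) (var 2)))
    (meet (join (var 0) (var 1)) (var 3))) (meet (var 2) (var 3))
  have key := hN (meet s t) s (by
    intro f
    simp only [s, t, eval]
    generalize f 0 = x, f 1 = y, f 2 = z, f 3 = w
    revert x y z w
    decide +kernel) (fun n => if n = 0 then p else if n = 1 then q else if n = 2 then r else a)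
  have key' : ((p ⊔ q) ⊓ (p ⊔ r) ⊓ (p ⊔ a)) ⊓
      (p ⊔ ((p ⊔ q) ⊓ r) ⊔ ((p ⊔ q) ⊓ a) ⊔ (r ⊓ a)) = (p ⊔ q) ⊓ (p ⊔ r) ⊓ (p ⊔ a) := key
  rwa [sup_eq_right.2 h, inf_eq_left] at key'

/-- In the pentagon, two elements that are complementary to `p < q` have a join not above `q`. -/
theorem inf_sup_inf_sup_le_sup_inf (hN : InVarietyGeneratedBy Pentagon L) {p q : L} (h : p ≤ q)
    (r a : L) : q ⊓ (p ⊔ r) ⊓ (p ⊔ a) ⊓ (r ⊔ a) ≤ p ⊔ (q ⊓ r) ⊔ (q ⊓ a) := by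
  -- Same encoding; this inequality is the order dual of `inf_sup_le_sup_inf_sup_inf`.
  let s : LatticeTerm ℕ := meet (meet (meet (join (var 0) (var 1)) (join (var 0) (var 2)))
    (join (var 0) (var 3))) (join (var 2) (var 3))
  let t : LatticeTerm ℕ := join (join (var 0) (meet (join (var 0) (var 1)) (var 2)))
    (meet (join (var 0) (var 1)) (var 3))
  have key := hN (meet s t) s (by
    intro f
    simp only [s, t, eval]
    generalize f 0 = x, f 1 = y, f 2 = z, f 3 = w
    revert x y z w
    decide +kernel) (fun n => if n = 0 then p else if n = 1 then q else if n = 2 then r else a)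
  have key' : ((p ⊔ q) ⊓ (p ⊔ r) ⊓ (p ⊔ a) ⊓ (r ⊔ a)) ⊓
      (p ⊔ ((p ⊔ q) ⊓ r) ⊔ ((p ⊔ q) ⊓ a)) = (p ⊔ q) ⊓ (p ⊔ r) ⊓ (p ⊔ a) ⊓ (r ⊔ a) := key
  rwa [sup_eq_right.2 h, inf_eq_left] at key'

/-- A pentagon `p ⊓ r, p, q, r, p ⊔ r` collapses when `p`, `q` and `p ⊔ r` have the same join and
the same meet with some element. -/
theorem eq_of_inf_eq_inf_sup (hN : InVarietyGeneratedBy Pentagon L) {p q r a : L} (h : p ≤ q)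
    (hs : p ⊔ r = q ⊔ r) (hi : p ⊓ r = q ⊓ r) (has : a ⊔ p = a ⊔ q) (hai : a ⊓ p = a ⊓ q)
    (har : a ⊓ p = a ⊓ (p ⊔ r)) : p = q := by
  refine le_antisymm h ?_
  calc q ≤ q ⊓ (p ⊔ r) ⊓ (p ⊔ a) :=
        le_inf (le_inf le_rfl (hs ▸ le_sup_left)) (by rw [sup_comm, has]; exact le_sup_right)
    _ ≤ p ⊔ (q ⊓ r) ⊔ (q ⊓ a) ⊔ (r ⊓ a) := hN.inf_sup_le_sup_inf_sup_inf h r a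
    _ ≤ p := by
        refine sup_le (sup_le (sup_le le_rfl ?_) ?_) ?_
        · exact hi ▸ inf_le_left
        · rw [inf_comm, ← hai]; exact inf_le_right
        · calc r ⊓ a ≤ a ⊓ (p ⊔ r) := le_inf inf_le_right (inf_le_left.trans le_sup_right)
            _ ≤ p := har ▸ inf_le_right

/-- A pentagon `p ⊓ r, p, q, r, p ⊔ r` collapses when `p`, `q` and `p ⊓ r` have the same join and
the same meet with some element. -/
theorem eq_of_sup_eq_sup_inf (hN : InVarietyGeneratedBy Pentagon L) {p q r a : L} (h : p ≤ q)
    (hs : p ⊔ r = q ⊔ r) (hi : p ⊓ r = q ⊓ r) (has : a ⊔ p = a ⊔ q) (hai : a ⊓ p = a ⊓ q)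
    (har : a ⊔ p = a ⊔ (p ⊓ r)) : p = q := by
  refine le_antisymm h ?_
  calc q ≤ q ⊓ (p ⊔ r) ⊓ (p ⊔ a) ⊓ (r ⊔ a) := by
        refine le_inf (le_inf (le_inf le_rfl ?_) ?_) ?_
        · exact hs ▸ le_sup_left
        · rw [sup_comm, has]; exact le_sup_right
        · calc q ≤ a ⊔ (p ⊓ r) := by rw [← har, has]; exact le_sup_right
            _ ≤ r ⊔ a := sup_le le_sup_right (inf_le_right.trans le_sup_left)
    _ ≤ p ⊔ (q ⊓ r) ⊔ (q ⊓ a) := hN.inf_sup_inf_sup_le_sup_inf h r a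
    _ ≤ p := by
        refine sup_le (sup_le le_rfl ?_) ?_
        · exact hi ▸ inf_le_left
        · rw [inf_comm, ← hai]; exact inf_le_right

end InVarietyGeneratedBy

/-- The join and the meet of `a` with an element. -/
def joinMeet {L : Type u} [Lattice L] (a b : L) : L × L := (a ⊔ b, a ⊓ b)

/-! ### Fibers of `joinMeet a` -/

section joinMeet

variable {L : Type u} [Lattice L] {a x y z : L} {c d : L × L}

theorem joinMeet_eq_of_mem_Icc (hx : joinMeet a x = c) (hy : joinMeet a y = c) (hxz : x ≤ z)
    (hzy : z ≤ y) : joinMeet a z = c := by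
  subst hx
  simp only [joinMeet, Prod.mk.injEq] at hy ⊢
  exact ⟨le_antisymm ((sup_le_sup_left hzy a).trans hy.1.le) (sup_le_sup_left hxz a),
    le_antisymm ((inf_le_inf_left a hzy).trans hy.2.le) (inf_le_inf_left a hxz)⟩

/-- Only the meet coordinate needs the variety: it is meet-semidistributivity. -/
theorem joinMeet_sup (hN : InVarietyGeneratedBy Pentagon L) (hx : joinMeet a x = c)
    (hy : joinMeet a y = c) : joinMeet a (x ⊔ y) = c := by
  subst hx
  simp only [joinMeet, Prod.mk.injEq] at hy ⊢
  exact ⟨by rw [sup_sup_distrib_left, hy.1, sup_idem], hN.inf_sup_eq_of_inf_eq hy.2.symm⟩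

theorem joinMeet_inf (hN : InVarietyGeneratedBy Pentagon L) (hx : joinMeet a x = c)
    (hy : joinMeet a y = c) : joinMeet a (x ⊓ y) = c := by
  subst hx
  simp only [joinMeet, Prod.mk.injEq] at hy ⊢
  exact ⟨hN.sup_inf_eq_of_sup_eq hy.1.symm, by rw [inf_inf_distrib_left, hy.2, inf_idem]⟩

/-- A sublattice covered by two fibers of `joinMeet a` contains no pentagon. -/
theorem eq_of_sup_eq_of_inf_eq (hN : InVarietyGeneratedBy Pentagon L) {G : Set L}
    (hG : IsSublattice G) (hcd : ∀ x ∈ G, joinMeet a x = c ∨ joinMeet a x = d) {p q r : L}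
    (hp : p ∈ G) (hq : q ∈ G) (hr : r ∈ G) (h : p ≤ q) (hs : p ⊔ r = q ⊔ r)
    (hi : p ⊓ r = q ⊓ r) : p = q := by
  have hsG := hcd _ (hG.supClosed hp hr)
  have hiG := hcd _ (hG.infClosed hp hr)
  have main : joinMeet a p = joinMeet a q ∧
      (joinMeet a p = joinMeet a (p ⊔ r) ∨ joinMeet a p = joinMeet a (p ⊓ r)) := by
    -- If bottom and top of the pentagon share a fiber, convexity puts all of it there.
    by_cases h01 : joinMeet a (p ⊓ r) = joinMeet a (p ⊔ r)
    · have h1 := joinMeet_eq_of_mem_Icc h01 rfl inf_le_left (le_sup_left : p ≤ p ⊔ r)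
      have h2 := joinMeet_eq_of_mem_Icc h01 rfl (hi ▸ inf_le_left) (hs ▸ le_sup_left : q ≤ p ⊔ r)
      exact ⟨h1.trans h2.symm, Or.inl h1⟩
    -- Otherwise bottom and top represent the two fibers. If `r` lies with the bottom, then `p` and
    -- `q` cannot, since fibers are closed under joins; hence they lie with the top. The other case
    -- is dual.
    · have two : ∀ x ∈ G, joinMeet a x = joinMeet a (p ⊓ r) ∨ joinMeet a x = joinMeet a (p ⊔ r) := by
        intro x hx
        have := hcd x hx
        grind
      rcases two r hr with hr0 | hr1
      · have up : ∀ x ∈ G, x ⊔ r = p ⊔ r → joinMeet a x = joinMeet a (p ⊔ r) := fun x hx hxr =>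
          (two x hx).resolve_left fun h0 => h01 (hxr ▸ (joinMeet_sup hN h0 hr0).symm)
        exact ⟨(up p hp rfl).trans (up q hq hs.symm).symm, Or.inl (up p hp rfl)⟩
      · have down : ∀ x ∈ G, x ⊓ r = p ⊓ r → joinMeet a x = joinMeet a (p ⊓ r) := fun x hx hxr =>
          (two x hx).resolve_right fun h1 => h01 (hxr ▸ joinMeet_inf hN h1 hr1)
        exact ⟨(down p hp rfl).trans (down q hq hi.symm).symm, Or.inr (down p hp rfl)⟩
  simp only [joinMeet, Prod.mk.injEq] at main
  obtain ⟨⟨has, hai⟩, ⟨-, h1⟩ | ⟨h0, -⟩⟩ := main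
  · exact hN.eq_of_inf_eq_inf_sup h hs hi has hai h1
  · exact hN.eq_of_sup_eq_sup_inf h hs hi has hai h0

/-- A sublattice covered by two fibers of `joinMeet a` is modular. -/
theorem sup_inf_assoc_of_joinMeet (hN : InVarietyGeneratedBy Pentagon L) {G : Set L}
    (hG : IsSublattice G) (hcd : ∀ x ∈ G, joinMeet a x = c ∨ joinMeet a x = d)
    (hx : x ∈ G) (hy : y ∈ G) (hz : z ∈ G) (h : x ≤ z) : x ⊔ (y ⊓ z) = (x ⊔ y) ⊓ z := by
  have hle : x ⊔ (y ⊓ z) ≤ (x ⊔ y) ⊓ z :=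
    sup_le (le_inf le_sup_left h) (le_inf (inf_le_left.trans le_sup_right) inf_le_right)
  -- Dedekind's pentagon: both sides have join `x ⊔ y` and meet `y ⊓ z` with `y`.
  refine eq_of_sup_eq_of_inf_eq hN hG hcd (hG.supClosed hx (hG.infClosed hy hz))
    (hG.infClosed (hG.supClosed hx hy) hz) hy hle ?_ ?_
  · refine le_antisymm (sup_le_sup_right hle y) (sup_le (inf_le_left.trans ?_) le_sup_right)
    exact sup_le (le_sup_left.trans le_sup_left) le_sup_right
  · refine le_antisymm (inf_le_inf_right y hle) (le_inf ?_ inf_le_right)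
    exact (le_inf inf_le_right (inf_le_left.trans inf_le_right)).trans le_sup_right

/-- Modularity rewrites the inner term of `inf_sup_eq` as `(x ⊓ y) ⊔ (x ⊓ z)`; `y` absorbs `x ⊓ y`,
and modularity once more evaluates `x ⊓ (y ⊔ (x ⊓ z))`. -/
theorem inf_sup_distrib_of_joinMeet (hN : InVarietyGeneratedBy Pentagon L) {G : Set L}
    (hG : IsSublattice G) (hcd : ∀ x ∈ G, joinMeet a x = c ∨ joinMeet a x = d)
    (hx : x ∈ G) (hy : y ∈ G) (hz : z ∈ G) : x ⊓ (y ⊔ z) = (x ⊓ y) ⊔ (x ⊓ z) := by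
  have hxy := hG.infClosed hx hy
  have hxz := hG.infClosed hx hz
  have m1 := sup_inf_assoc_of_joinMeet hN hG hcd hxy hz hx inf_le_left
  have m2 := sup_inf_assoc_of_joinMeet hN hG hcd hxz hy hx inf_le_left
  rw [hN.inf_sup_eq, inf_comm x (z ⊔ _), sup_comm z, ← m1, ← sup_assoc,
    sup_eq_left.2 (inf_le_right : x ⊓ y ≤ y), inf_comm z x, inf_comm, sup_comm, ← m2, sup_comm,
    inf_comm y]

theorem sup_inf_distrib_of_joinMeet (hN : InVarietyGeneratedBy Pentagon L) {G : Set L}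
    (hG : IsSublattice G) (hcd : ∀ x ∈ G, joinMeet a x = c ∨ joinMeet a x = d)
    (hx : x ∈ G) (hy : y ∈ G) (hz : z ∈ G) : x ⊔ (y ⊓ z) = (x ⊔ y) ⊓ (x ⊔ z) := by
  rw [inf_sup_distrib_of_joinMeet hN hG hcd (hG.supClosed hx hy) hx hz, inf_comm (x ⊔ y) x,
    inf_sup_self, inf_comm (x ⊔ y) z, inf_sup_distrib_of_joinMeet hN hG hcd hz hx hy, ← sup_assoc,
    sup_eq_left.2 (inf_le_right : z ⊓ x ≤ x), inf_comm z y]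

/-- A convex sublattice covered by two fibers of `joinMeet a` is distributive. -/
theorem isConvexDistributiveSublattice_of_joinMeet (hN : InVarietyGeneratedBy Pentagon L)
    (K : Sublattice L) {G : Set K} (hG : IsSublattice G) (hc : G.OrdConnected)
    (hcd : ∀ x ∈ G, joinMeet a (x : L) = c ∨ joinMeet a (x : L) = d) :
    IsConvexDistributiveSublattice G := by
  have hG' : IsSublattice (K.subtype '' G) := hG.image _
  have hcd' : ∀ x ∈ K.subtype '' G, joinMeet a x = c ∨ joinMeet a x = d := by
    rintro _ ⟨x, hx, rfl⟩
    exact hcd x hx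
  refine ⟨hG, hc, fun x hx y hy z hz => Subtype.ext ?_, fun x hx y hy z hz => Subtype.ext ?_⟩
  · exact sup_inf_distrib_of_joinMeet hN hG' hcd' ⟨x, hx, rfl⟩ ⟨y, hy, rfl⟩ ⟨z, hz, rfl⟩
  · exact inf_sup_distrib_of_joinMeet hN hG' hcd' ⟨x, hx, rfl⟩ ⟨y, hy, rfl⟩ ⟨z, hz, rfl⟩

/-- The fibers of `joinMeet a` form a distributive partition. -/
theorem isDistributivePartition_joinMeet (hN : InVarietyGeneratedBy Pentagon L)
    (K : Sublattice L) (a : L) :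
    IsDistributivePartition (Setoid.ker fun b : K => joinMeet a (b : L)).classes := by
  refine ⟨Setoid.isPartition_classes _, ?_, ?_⟩
  · rintro _ ⟨y, rfl⟩
    -- A single fiber is the case of two equal values, so `d` is a filler.
    refine isConvexDistributiveSublattice_of_joinMeet hN K (a := a)
      (d := joinMeet a (y : L)) ⟨?_, ?_⟩ ⟨?_⟩ (fun x hx => Or.inl hx)
    · exact fun x hx z hz => joinMeet_sup hN hx hz
    · exact fun x hx z hz => joinMeet_inf hN hx hz
    · exact fun x hx z hz w hw => joinMeet_eq_of_mem_Icc hx hz hw.1 hw.2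
  · rintro _ ⟨y, rfl⟩ _ ⟨z, rfl⟩ -
    by_cases hs : IsSublattice ({x | Setoid.ker (fun b : K => joinMeet a (b : L)) x y} ∪
        {x | Setoid.ker (fun b : K => joinMeet a (b : L)) x z})
    · by_cases hc : ({x | Setoid.ker (fun b : K => joinMeet a (b : L)) x y} ∪
          {x | Setoid.ker (fun b : K => joinMeet a (b : L)) x z}).OrdConnected
      · exact Or.inr (Or.inr
          (isConvexDistributiveSublattice_of_joinMeet hN K hs hc fun x hx => hx))
      · exact Or.inr (Or.inl hc)
    · exact Or.inl hs

end joinMeet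

theorem theorem5 {L : Type u} [Lattice L]
    (hN : InVarietyGeneratedBy Pentagon L)
    (hfree : ∃ (S : Type v) (e : LatticeHom L (FreeLattice S)), Function.Injective e)
    (K : Sublattice L) (a : L) (ha : ∀ b ∈ K, ¬ a ≤ b ∧ ¬ b ≤ a) :
    Dec K ≤ Cardinal.mk
      (((fun b : L => a ⊔ b) '' (K : Set L)) ×ˢ ((fun b : L => a ⊓ b) '' (K : Set L)) :
        Set (L × L)) := by
  have hDec : Dec K ≤ Cardinal.mk (Setoid.ker fun b : K => joinMeet a (b : L)).classes :=
    csInf_le' ⟨_, isDistributivePartition_joinMeet hN K a, rfl⟩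
  refine hDec.trans ?_
  -- Fibers correspond to values of `joinMeet a` on `K`, all of which lie in the product.
  have e := (Setoid.quotientEquivClasses (Setoid.ker fun b : K => joinMeet a (b : L))).symm.trans
    (Setoid.quotientKerEquivRange _)
  rw [Cardinal.mk_congr e]
  refine Cardinal.mk_le_mk_of_subset ?_
  rintro _ ⟨b, rfl⟩
  exact ⟨⟨b, b.2, rfl⟩, ⟨b, b.2, rfl⟩⟩
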